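/- Let $T$ be a (nondegenerate) triangle with angles $A,B,C$, not all of them rational multiples of $\pi$, such that $C=A/2+B$ and such that $2\sin(A/4)$ is rational, say $2\sin(A/4)=M/K$ with integers $M,K$, $K\neq 0$. A tiling of $T$ by a triangle $R$ (the tile) is a dissection of $T$ into finitely many triangles congruent to $R$ (reflections allowed) with pairwise disjoint interiors; it need not be edge-to-edge. Then there is a triangle $R$ with angles $\alpha=A/2$, $\beta=B$, $\gamma=\pi-\alpha-\beta$ such that $T$ has a tiling by $R$. Moreover, for every triangle $R$ with these angles and every tiling of $T$ by $R$, the number of tiles is a perfect square if and only if $2K^2-M^2$ is a perfect square. -/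

import Mathlib

namespace TriangleTiling

/-- The Euclidean plane. -/
abbrev Plane : Type := EuclideanSpace ℝ (Fin 2)

/-- Nondegenerate triangles in the plane, with labelled vertices. -/
abbrev Tri : Type := Affine.Triangle ℝ Plane

/-- The angle of a triangle at its vertex `i` (indices modulo 3). -/
noncomputable def angleAt (T : Tri) (i : Fin 3) : ℝ :=
  EuclideanGeometry.angle (T.points (i + 1)) (T.points i) (T.points (i + 2))

/-- All angles are rational multiples of `π`. -/
def CommensurableAngles (T : Tri) : Prop :=
  ∀ i : Fin 3, ∃ q : ℚ, angleAt T i = (q : ℝ) * Real.pi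

/-- Not all angles are rational multiples of `π`. -/
def IncommensurableAngles (T : Tri) : Prop := ¬ CommensurableAngles T

/-- The closed region bounded by a triangle. -/
def region (T : Tri) : Set Plane := convexHull ℝ (Set.range T.points)

/-- The triangles `t 0, …, t (N - 1)` tile `T` by congruent copies of `R`: each of them is
congruent to `R` (reflections allowed; the vertices are labelled so that corresponding vertices of
`R` and of the copy have the same label), they have pairwise disjoint interiors, and together they
fill `T`. The tiling need not be edge-to-edge. -/
structure IsTiling (T R : Tri) {N : ℕ} (t : Fin N → Tri) : Prop where
  congruent : ∀ j, Congruent (t j).points R.points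
  disjoint : ∀ j k, j ≠ k → Disjoint (interior (region (t j))) (interior (region (t k)))
  cover : ⋃ j, region (t j) = region T

/-- `T` has a tiling with exactly `N` tiles, all congruent to `R`. -/
def HasTiling (T R : Tri) (N : ℕ) : Prop := ∃ t : Fin N → Tri, IsTiling T R t

end TriangleTiling

/-!
Write `A = 4θ` and `s = 2 sin θ`, and let `α = 2θ`, `β = B`, `γ` be the angles of the tile.
The angle sum gives `B = π/2 - 3θ`, so `0 < θ < π/6` and
`0 < s < 1`. By the law of sines the tile has sides in the ratio `1 : s : 1 - s²`
(`tile_sides`), and `T` has sides in the ratio `1 : s(2 - s²) : 1 - s²` (`tiled_sides`), listed in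
the order of the edges `01`, `12`, `02`. Hence a rational `s = m/k` makes all sides of the tile
commensurable.

*Existence.* Let `P`, `Q`, `V` be the vertices of `T` with labels `0`, `1`, `2`. For any point `E`
inside `T`, the parallelogram with sides along `QP` and `QV` and opposite vertices `Q` and `E`,
together with three triangles with vertex `E`, dissects `T` (`iUnion_pieces`,
`pairwise_disjoint_pieces`). At the point `E` with coordinates `s²` and `(1 - s²)/(2 - s²)` with
respect to `QP` and `QV`, the four angles of this dissection are `γ, γ, γ, β`, and all three
triangles are similar to the tile. When `s = m/k`, a tile of the right size fits into them with the
integral ratios `k² - m²`, `m k`, `k² - m²`, and the sides of the parallelogram are integral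
multiples of the two sides of the tile that enclose `β`. So each piece is cut into tiles by a
lattice (`SpansTile.tiledBy_triSet_nsmul`, `SpansTile.tiledBy_parSet_nsmul`).

*The number of tiles.* In any tiling, comparing areas gives `N c² = Z² (2 - s²)`, where `Z` and `c`
are the sides `01` of `T` and of the tile (`IsTiling.twiceArea_eq`). The side of `T` is covered
by sides of tiles that overlap only in endpoints: two tiles whose sides overlapped in a segment of
it would lie on the same side of it and share interior points. So `Z` is a sum of sides of the tile
(`IsTiling.exists_dist_eq_sum`), hence a rational multiple of `c`, and `N K²` equals
`2K² - M²` up to the square of a nonzero rational number.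
-/

namespace TriangleTiling

open Set Filter Topology MeasureTheory

/-! ### Coordinates in the plane -/

/-- The determinant of two vectors of the plane. -/
noncomputable def cross (u v : Plane) : ℝ := u 0 * v 1 - u 1 * v 0

/-- The squared determinant as a function of the side lengths of the triangle spanned by `u` and
`v` (Heron's formula). -/
theorem cross_sq (u v : Plane) :
    cross u v ^ 2 =
      ‖u‖ ^ 2 * ‖v‖ ^ 2 - ((‖u‖ ^ 2 + ‖v‖ ^ 2 - ‖u - v‖ ^ 2) / 2) ^ 2 := by
  simp only [EuclideanSpace.norm_sq_eq, Fin.sum_univ_two, Real.norm_eq_abs, sq_abs, cross,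
    PiLp.sub_apply]
  ring

theorem smul_add_smul_eq_zero {u v : Plane} (h : cross u v ≠ 0) {x y : ℝ}
    (hxy : x • u + y • v = 0) : x = 0 ∧ y = 0 := by
  have h0 : x * u 0 + y * v 0 = 0 := by simpa using congrArg (fun p : Plane => p 0) hxy
  have h1 : x * u 1 + y * v 1 = 0 := by simpa using congrArg (fun p : Plane => p 1) hxy
  constructor
  · refine (mul_eq_zero.1 ?_).resolve_right h
    unfold cross
    linear_combination v 1 * h0 - v 0 * h1
  · refine (mul_eq_zero.1 ?_).resolve_right h
    unfold cross
    linear_combination u 0 * h1 - u 1 * h0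

theorem affineIndependent_iff_cross (p : Fin 3 → Plane) :
    AffineIndependent ℝ p ↔ cross (p 0 - p 1) (p 2 - p 1) ≠ 0 := by
  rw [affineIndependent_iff_linearIndependent_vsub ℝ p 1]
  let e : Fin 2 ≃ {x : Fin 3 // x ≠ 1} :=
    { toFun := ![⟨0, by decide⟩, ⟨2, by decide⟩]
      invFun := fun x => if x.1 = 0 then 0 else 1
      left_inv := by intro i; fin_cases i <;> rfl
      right_inv := by
        rintro ⟨i, hi⟩
        fin_cases i
        · rfl
        · exact absurd rfl hi
        · rfl }
  rw [← linearIndependent_equiv e]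
  have : ((fun i : {x : Fin 3 // x ≠ 1} => p i -ᵥ p 1) ∘ e) = ![p 0 - p 1, p 2 - p 1] := by
    ext i : 1
    fin_cases i <;> rfl
  rw [this, LinearIndependent.pair_iff]
  constructor
  · intro h h0
    have h0' : (p 0 - p 1) 0 * (p 2 - p 1) 1 - (p 0 - p 1) 1 * (p 2 - p 1) 0 = 0 := h0
    have key : ∀ i : Fin 2, (p 0 - p 1) i = 0 ∧ (p 2 - p 1) i = 0 := by
      intro i
      have := h ((p 2 - p 1) i) (-(p 0 - p 1) i) (by
        ext j
        fin_cases i <;> fin_cases j <;> simp at h0' ⊢ <;> linarith)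
      exact ⟨neg_eq_zero.1 this.2, this.1⟩
    have hz : p 0 - p 1 = 0 := by
      ext i
      exact (key i).1
    have := (h 1 0 (by simp [hz])).1
    exact one_ne_zero this
  · intro h x y hxy
    exact smul_add_smul_eq_zero h hxy

theorem cross_ne_zero (S : Tri) :
    cross (S.points 0 - S.points 1) (S.points 2 - S.points 1) ≠ 0 :=
  (affineIndependent_iff_cross _).1 S.independent

/-- The triangle with vertices `o`, `o + u`, `o + v`. -/
def triSet (o u v : Plane) : Set Plane :=
  {p | ∃ x y : ℝ, 0 ≤ x ∧ 0 ≤ y ∧ x + y ≤ 1 ∧ p = o + x • u + y • v}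

/-- The parallelogram with vertex `o` and edges `u`, `v`. -/
def parSet (o u v : Plane) : Set Plane :=
  {p | ∃ x y : ℝ, 0 ≤ x ∧ x ≤ 1 ∧ 0 ≤ y ∧ y ≤ 1 ∧ p = o + x • u + y • v}

theorem region_eq_triSet (S : Tri) :
    region S = triSet (S.points 1) (S.points 0 - S.points 1) (S.points 2 - S.points 1) := by
  apply Subset.antisymm
  · apply convexHull_min
    · rintro _ ⟨i, rfl⟩
      fin_cases i
      · exact ⟨1, 0, by norm_num, by norm_num, by norm_num, by simp⟩
      · exact ⟨0, 0, by norm_num, by norm_num, by norm_num, by simp⟩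
      · exact ⟨0, 1, by norm_num, by norm_num, by norm_num, by simp⟩
    · rintro _ ⟨x, y, hx, hy, hxy, rfl⟩ _ ⟨x', y', hx', hy', hxy', rfl⟩ a b ha hb hab
      refine ⟨a * x + b * x', a * y + b * y', by positivity, by positivity, ?_, ?_⟩
      · have h1 := mul_le_mul_of_nonneg_left hxy ha
        have h2 := mul_le_mul_of_nonneg_left hxy' hb
        linarith
      · obtain rfl : b = 1 - a := by linarith
        module
  · rintro _ ⟨x, y, hx, hy, hxy, rfl⟩
    have hm : ∀ i, S.points i ∈ region S := fun i => subset_convexHull ℝ _ (mem_range_self i)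
    have := (convex_convexHull ℝ (range S.points)).sum_mem (t := Finset.univ)
      (w := ![x, 1 - x - y, y]) (z := S.points)
      (by intro i _; fin_cases i <;> simp <;> linarith)
      (by simp [Fin.sum_univ_three]; ring)
      (fun i _ => hm i)
    have e : S.points 1 + x • (S.points 0 - S.points 1) + y • (S.points 2 - S.points 1) =
        ∑ i, (![x, 1 - x - y, y] : Fin 3 → ℝ) i • S.points i := by
      simp [Fin.sum_univ_three]
      module
    rw [e]
    exact this

/-- Two sets on different sides of a line, here given in the coordinates with respect to an affine
frame `o, u, v`, have disjoint interiors. -/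
theorem disjoint_interior_of_coord {o u v : Plane} (h : cross u v ≠ 0) {a b k : ℝ}
    (hab : a ≠ 0 ∨ b ≠ 0) {S S' : Set Plane}
    (hS : ∀ p ∈ S, ∃ x y : ℝ, p = o + x • u + y • v ∧ a * x + b * y ≤ k)
    (hS' : ∀ p ∈ S', ∃ x y : ℝ, p = o + x • u + y • v ∧ k ≤ a * x + b * y) :
    Disjoint (interior S) (interior S') := by
  rw [Set.disjoint_left]
  intro p hp hp'
  obtain ⟨x, y, rfl, hxy⟩ := hS' p (interior_subset hp')
  -- moving into the second half-plane keeps the point in the interior of `S` for a short time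
  have hc : Tendsto (fun ε : ℝ => o + x • u + y • v + ε • (a • u + b • v)) (𝓝[>] 0)
      (𝓝 (o + x • u + y • v)) := by
    have : Continuous (fun ε : ℝ => o + x • u + y • v + ε • (a • u + b • v)) := by fun_prop
    simpa using (this.tendsto 0).mono_left nhdsWithin_le_nhds
  have hev := hc.eventually (isOpen_interior.mem_nhds hp)
  obtain ⟨ε, hε, hε0⟩ := (hev.and self_mem_nhdsWithin).exists
  have hε0 : 0 < ε := hε0
  obtain ⟨x', y', he, hle⟩ := hS _ (interior_subset hε)
  have h0 : (x + ε * a - x') • u + (y + ε * b - y') • v = 0 := by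
    have : (x + ε * a - x') • u + (y + ε * b - y') • v =
      (o + x • u + y • v + ε • (a • u + b • v)) - (o + x' • u + y' • v) := by module
    rw [this, he, sub_self]
  obtain ⟨hx', hy'⟩ := smul_add_smul_eq_zero h h0
  obtain rfl : x' = x + ε * a := by linarith
  obtain rfl : y' = y + ε * b := by linarith
  have hpos : 0 < a ^ 2 + b ^ 2 := by
    rcases hab with h | h <;> positivity
  have := mul_pos hε0 hpos
  nlinarith

/-! ### Dissecting sets into copies of a tile -/

/-- The set `S` is a union of finitely many triangles that are congruent to `R` and have disjoint
interiors. In contrast to `HasTiling`, the set is arbitrary and the tiles are indexed by any finite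
type, so that tilings of pieces can be glued. -/
def TiledBy (R : Tri) (S : Set Plane) : Prop :=
  ∃ (ι : Type) (_ : Finite ι) (t : ι → Tri), (∀ j, Congruent (t j).points R.points) ∧
    (∀ j k, j ≠ k → Disjoint (interior (region (t j))) (interior (region (t k)))) ∧
    ⋃ j, region (t j) = S

theorem TiledBy.exists_hasTiling {R T : Tri} (h : TiledBy R (region T)) :
    ∃ N, HasTiling T R N := by
  obtain ⟨ι, _, t, h1, h2, h3⟩ := h
  obtain ⟨n, ⟨e⟩⟩ := Finite.exists_equiv_fin ι
  refine ⟨n, t ∘ e.symm, fun j => h1 _, fun j k hjk => h2 _ _ (by simpa using hjk), ?_⟩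
  rw [← h3]
  exact e.symm.surjective.iUnion_comp (fun j => region (t j))

theorem TiledBy.union {R : Tri} {S S' : Set Plane} (h : TiledBy R S) (h' : TiledBy R S')
    (hd : Disjoint (interior S) (interior S')) : TiledBy R (S ∪ S') := by
  obtain ⟨ι, _, t, h1, h2, rfl⟩ := h
  obtain ⟨κ, _, t', h1', h2', rfl⟩ := h'
  have key : ∀ j k, Disjoint (interior (region (t j))) (interior (region (t' k))) := fun j k =>
    hd.mono (interior_mono (subset_iUnion (fun j => region (t j)) j))
      (interior_mono (subset_iUnion (fun j => region (t' j)) k))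
  refine ⟨ι ⊕ κ, inferInstance, Sum.elim t t', ?_, ?_, ?_⟩
  · rintro (j | j)
    · exact h1 j
    · exact h1' j
  · rintro (j | j) (k | k) hjk
    · exact h2 j k (by simpa using hjk)
    · exact key j k
    · exact (key k j).symm
    · exact h2' j k (by simpa using hjk)
  · rw [iUnion_sum]
    rfl

theorem TiledBy.iUnion {R : Tri} {κ : Type} [Finite κ] {S : κ → Set Plane}
    (h : ∀ k, TiledBy R (S k))
    (hd : Pairwise fun k l => Disjoint (interior (S k)) (interior (S l))) :
    TiledBy R (⋃ k, S k) := by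
  choose ι hι t h1 h2 h3 using h
  have hsub : ∀ k j, region (t k j) ⊆ S k := fun k j =>
    (subset_iUnion (fun j => region (t k j)) j).trans (h3 k).subset
  refine ⟨Σ k, ι k, inferInstance, fun j => t j.1 j.2, fun j => h1 _ _, ?_, ?_⟩
  · rintro ⟨k, j⟩ ⟨l, i⟩ hne
    by_cases hkl : k = l
    · subst hkl
      exact h2 k j i fun e => hne (by rw [e])
    · exact (hd hkl).mono (interior_mono (hsub k j)) (interior_mono (hsub l i))
  · rw [iUnion_sigma]
    exact iUnion_congr h3

/-- The vectors `u` and `v` are the sides at vertex `1` of a triangle congruent to `R`. -/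
structure SpansTile (R : Tri) (u v : Plane) : Prop where
  norm_left : ‖u‖ = dist (R.points 0) (R.points 1)
  norm_right : ‖v‖ = dist (R.points 1) (R.points 2)
  norm_sub : ‖u - v‖ = dist (R.points 0) (R.points 2)

theorem SpansTile.neg {R : Tri} {u v : Plane} (h : SpansTile R u v) : SpansTile R (-u) (-v) :=
  ⟨by rw [norm_neg, h.norm_left], by rw [norm_neg, h.norm_right], by
    rw [neg_sub_neg, norm_sub_rev, h.norm_sub]⟩

theorem SpansTile.cross_ne_zero {R : Tri} {u v : Plane} (h : SpansTile R u v) :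
    cross u v ≠ 0 := by
  have hR := TriangleTiling.cross_ne_zero R
  have : cross u v ^ 2 = cross (R.points 0 - R.points 1) (R.points 2 - R.points 1) ^ 2 := by
    rw [cross_sq, cross_sq, h.norm_left, h.norm_right, h.norm_sub, sub_sub_sub_cancel_right,
      ← dist_eq_norm, ← dist_eq_norm, ← dist_eq_norm, dist_comm (R.points 1) (R.points 2)]
  intro h0
  rw [h0, zero_pow two_ne_zero] at this
  exact hR (pow_eq_zero_iff two_ne_zero |>.1 this.symm)

theorem SpansTile.tiledBy_triSet {R : Tri} {u v : Plane} (h : SpansTile R u v) (o : Plane) :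
    TiledBy R (triSet o u v) := by
  let S : Tri := ⟨![o + u, o, o + v], by
    rw [affineIndependent_iff_cross]
    simpa using h.cross_ne_zero⟩
  have hS : region S = triSet o u v := by
    rw [region_eq_triSet]
    simp [S]
  refine ⟨Unit, inferInstance, fun _ => S, fun _ => ?_, fun j k hjk => (hjk rfl).elim, ?_⟩
  · rw [congruent_iff_dist_eq]
    have e01 : dist (S.points 0) (S.points 1) = dist (R.points 0) (R.points 1) := by
      simp [S, dist_eq_norm, h.norm_left]
    have e12 : dist (S.points 1) (S.points 2) = dist (R.points 1) (R.points 2) := by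
      simp [S, h.norm_right]
    have e02 : dist (S.points 0) (S.points 2) = dist (R.points 0) (R.points 2) := by
      simp [S, dist_eq_norm] at *
      rw [h.norm_sub, dist_eq_norm]
    intro i j
    fin_cases i <;> fin_cases j <;>
      simp only [Fin.zero_eta, Fin.mk_one, Fin.reduceFinMk, dist_self] <;>
      first
        | assumption
        | (rw [dist_comm, dist_comm (R.points _)]; assumption)
  · exact (iUnion_const _).trans hS

/-! ### Parallelograms and triangles on the lattice of the tile -/

theorem SpansTile.tiledBy_parSet {R : Tri} {u v : Plane} (h : SpansTile R u v) (o : Plane) :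
    TiledBy R (parSet o u v) := by
  have hd : parSet o u v = triSet o u v ∪ triSet (o + u + v) (-u) (-v) := by
    ext p
    constructor
    · rintro ⟨x, y, hx, hx', hy, hy', rfl⟩
      rcases le_total (x + y) 1 with h1 | h1
      · exact Or.inl ⟨x, y, hx, hy, h1, rfl⟩
      · exact Or.inr ⟨1 - x, 1 - y, by linarith, by linarith, by linarith, by module⟩
    · rintro (⟨x, y, hx, hy, hxy, rfl⟩ | ⟨x, y, hx, hy, hxy, rfl⟩)
      · exact ⟨x, y, hx, by linarith, hy, by linarith, rfl⟩
      · exact ⟨1 - x, 1 - y, by linarith, by linarith, by linarith, by linarith, by module⟩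
  rw [hd]
  refine (h.tiledBy_triSet o).union (h.neg.tiledBy_triSet _) ?_
  refine disjoint_interior_of_coord (o := o) h.cross_ne_zero (a := 1) (b := 1) (k := 1)
    (by norm_num) ?_ ?_
  · rintro _ ⟨x, y, hx, hy, hxy, rfl⟩
    exact ⟨x, y, rfl, by linarith⟩
  · rintro _ ⟨x, y, hx, hy, hxy, rfl⟩
    exact ⟨1 - x, 1 - y, by module, by linarith⟩

/-- Gluing two parallelograms along the edge `v`. -/
theorem parSet_add_smul (o u v : Plane) {a b : ℝ} (ha : 0 ≤ a) (hb : 0 < b) :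
    parSet o ((a + b) • u) v = parSet o (a • u) v ∪ parSet (o + a • u) (b • u) v := by
  ext p
  constructor
  · rintro ⟨x, y, hx, hx', hy, hy', rfl⟩
    rcases le_or_gt ((a + b) * x) a with h1 | h1
    · rcases ha.eq_or_lt with rfl | ha
      · obtain rfl : x = 0 := by nlinarith
        exact Or.inl ⟨0, y, le_rfl, zero_le_one, hy, hy', by simp⟩
      · refine Or.inl ⟨(a + b) * x / a, y, by positivity, by rwa [div_le_one ha], hy, hy', ?_⟩
        rw [smul_smul, smul_smul]
        congr 3
        field_simp
    · refine Or.inr ⟨((a + b) * x - a) / b, y, div_nonneg (by linarith) hb.le, ?_, hy, hy', ?_⟩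
      · rw [div_le_one hb]
        nlinarith
      · have : ((a + b) * x - a) / b * b = (a + b) * x - a := div_mul_cancel₀ _ hb.ne'
        rw [smul_smul _ b, this]
        module
  · have hab : 0 < a + b := by linarith
    rintro (⟨x, y, hx, hx', hy, hy', rfl⟩ | ⟨x, y, hx, hx', hy, hy', rfl⟩)
    · refine ⟨a * x / (a + b), y, by positivity, ?_, hy, hy', ?_⟩
      · rw [div_le_one hab]
        nlinarith
      · have : a * x / (a + b) * (a + b) = a * x := div_mul_cancel₀ _ hab.ne'
        rw [smul_smul _ (a + b), this]
        module
    · refine ⟨(a + b * x) / (a + b), y, by positivity, ?_, hy, hy', ?_⟩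
      · rw [div_le_one hab]
        nlinarith
      · have : (a + b * x) / (a + b) * (a + b) = a + b * x := div_mul_cancel₀ _ hab.ne'
        rw [smul_smul _ (a + b), this]
        module

theorem parSet_swap (o u v : Plane) : parSet o u v = parSet o v u := by
  ext p
  constructor <;> rintro ⟨x, y, hx, hx', hy, hy', rfl⟩ <;>
    exact ⟨y, x, hy, hy', hx, hx', by module⟩

theorem cross_smul_left (a : ℝ) (u v : Plane) : cross (a • u) v = a * cross u v := by
  simp [cross]; ring

theorem cross_smul_right (a : ℝ) (u v : Plane) : cross u (a • v) = a * cross u v := by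
  simp [cross]; ring

theorem cross_swap (u v : Plane) : cross v u = -cross u v := by
  simp [cross]; ring

/-- A row of `n` translates of a tiled parallelogram. -/
theorem tiledBy_parSet_nsmul {R : Tri} {u v : Plane} (hc : cross u v ≠ 0)
    (h : ∀ o, TiledBy R (parSet o u v)) {n : ℕ} (hn : 0 < n) (o : Plane) :
    TiledBy R (parSet o ((n : ℝ) • u) v) := by
  induction n, hn using Nat.le_induction with
  | base => simpa using h o
  | succ n hn ih =>
    have hn' : (0 : ℝ) < n := by exact_mod_cast hn
    rw [Nat.cast_succ, parSet_add_smul o u v hn'.le one_pos, one_smul]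
    refine ih.union (h _) ?_
    refine disjoint_interior_of_coord (o := o) hc (a := 1) (b := 0) (k := n)
      (by norm_num) ?_ ?_
    · rintro _ ⟨x, y, hx, hx', hy, hy', rfl⟩
      exact ⟨x * n, y, by module, by nlinarith⟩
    · rintro _ ⟨x, y, hx, hx', hy, hy', rfl⟩
      exact ⟨x + n, y, by module, by nlinarith⟩

theorem SpansTile.tiledBy_parSet_nsmul {R : Tri} {u v : Plane} (h : SpansTile R u v) {m n : ℕ}
    (hm : 0 < m) (hn : 0 < n) (o : Plane) :
    TiledBy R (parSet o ((m : ℝ) • u) ((n : ℝ) • v)) := by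
  have hn' : (n : ℝ) ≠ 0 := by positivity
  refine TriangleTiling.tiledBy_parSet_nsmul ?_ (fun o => ?_) hm o
  · rw [cross_smul_right]
    exact mul_ne_zero hn' h.cross_ne_zero
  · rw [parSet_swap]
    refine TriangleTiling.tiledBy_parSet_nsmul ?_ (fun o => ?_) hn o
    · rw [cross_swap]
      exact neg_ne_zero.2 h.cross_ne_zero
    · rw [parSet_swap]
      exact h.tiledBy_parSet o

/-- Cutting the triangle of size `n + 1` along the lines `x = 1` and `y = n`. -/
theorem triSet_succ (o u v : Plane) {n : ℕ} (hn : 0 < n) :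
    triSet o (((n + 1 : ℕ) : ℝ) • u) (((n + 1 : ℕ) : ℝ) • v) =
      (parSet o u ((n : ℝ) • v) ∪ triSet (o + (n : ℝ) • v) u v) ∪
        triSet (o + u) ((n : ℝ) • u) ((n : ℝ) • v) := by
  have hn' : (0 : ℝ) < n := by exact_mod_cast hn
  push_cast
  ext p
  constructor
  · rintro ⟨x, y, hx, hy, hxy, rfl⟩
    rcases le_total 1 (x * (n + 1)) with h1 | h1
    · refine Or.inr ⟨(x * (n + 1) - 1) / n, y * (n + 1) / n, div_nonneg (by linarith) hn'.le,
        by positivity, ?_, ?_⟩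
      · rw [← add_div, div_le_one hn']
        nlinarith
      · rw [smul_smul _ (n : ℝ), smul_smul _ (n : ℝ), div_mul_cancel₀ _ hn'.ne',
          div_mul_cancel₀ _ hn'.ne']
        module
    · refine Or.inl ?_
      rcases le_total (y * (n + 1)) n with h2 | h2
      · refine Or.inl ⟨x * (n + 1), y * (n + 1) / n, by positivity, h1, by positivity,
          by rwa [div_le_one hn'], ?_⟩
        rw [smul_smul _ (n : ℝ), div_mul_cancel₀ _ hn'.ne']
        module
      · exact Or.inr ⟨x * (n + 1), y * (n + 1) - n, by positivity, by linarith, by nlinarith,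
          by module⟩
  · have key : ∀ x y : ℝ, 0 ≤ x → 0 ≤ y → x + y ≤ n + 1 → o + x • u + y • v ∈
        triSet o (((n : ℝ) + 1) • u) (((n : ℝ) + 1) • v) := by
      intro x y hx hy hxy
      have h1 : (0 : ℝ) < n + 1 := by linarith
      refine ⟨x / (n + 1), y / (n + 1), by positivity, by positivity, ?_, ?_⟩
      · rwa [← add_div, div_le_one h1]
      · rw [smul_smul _ (n + 1 : ℝ), smul_smul _ (n + 1 : ℝ), div_mul_cancel₀ _ h1.ne',
          div_mul_cancel₀ _ h1.ne']
    rintro ((⟨x, y, hx, hx', hy, hy', rfl⟩ | ⟨x, y, hx, hy, hxy, rfl⟩) | ⟨x, y, hx, hy, hxy, rfl⟩)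
    · convert! key x (y * n) hx (by positivity) (by nlinarith) using 1
      module
    · convert! key x (y + n) hx (by positivity) (by linarith) using 1
      module
    · convert! key (x * n + 1) (y * n) (by positivity) (by positivity) (by nlinarith) using 1
      module

/-- A triangle is tiled by `n ^ 2` copies of itself, scaled down by the factor `n`. -/
theorem SpansTile.tiledBy_triSet_nsmul {R : Tri} {u v : Plane} (h : SpansTile R u v) {n : ℕ}
    (hn : 0 < n) (o : Plane) : TiledBy R (triSet o ((n : ℝ) • u) ((n : ℝ) • v)) := by
  induction n, hn using Nat.le_induction generalizing o with
  | base => simpa using h.tiledBy_triSet o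
  | succ n hn ih =>
    have hn' : (1 : ℝ) ≤ n := by exact_mod_cast hn
    rw [triSet_succ o u v hn]
    have h1 := h.tiledBy_parSet_nsmul one_pos hn o
    rw [Nat.cast_one, one_smul] at h1
    refine (h1.union (h.tiledBy_triSet _) ?_).union (ih _) ?_
    · refine disjoint_interior_of_coord (o := o) h.cross_ne_zero (a := 0) (b := 1) (k := n)
        (by norm_num) ?_ ?_
      · rintro _ ⟨x, y, hx, hx', hy, hy', rfl⟩
        exact ⟨x, y * n, by module, by nlinarith⟩
      · rintro _ ⟨x, y, hx, hy, hxy, rfl⟩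
        exact ⟨x, y + n, by module, by nlinarith⟩
    · refine disjoint_interior_of_coord (o := o) h.cross_ne_zero (a := 1) (b := 0) (k := 1)
        (by norm_num) ?_ ?_
      · rintro _ (⟨x, y, hx, hx', hy, hy', rfl⟩ | ⟨x, y, hx, hy, hxy, rfl⟩)
        · exact ⟨x, y * n, by module, by nlinarith⟩
        · exact ⟨x, y + n, by module, by nlinarith⟩
      · rintro _ ⟨x, y, hx, hy, hxy, rfl⟩
        exact ⟨x * n + 1, y * n, by module, by nlinarith⟩

/-! ### Dissecting a triangle into a parallelogram and three triangles -/

/-- The pieces of the dissection of the triangle `o, o + u, o + v` by an interior point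
`e = o + f • u + g • v`: the parallelogram with diagonal from `o` to `e`, and the three triangles
with vertex `e` that remain. -/
def pieces (o u v : Plane) (f g : ℝ) : Fin 4 → Set Plane :=
  ![parSet o (f • u) (g • v), triSet (o + f • u) ((1 - f) • u) (g • v),
    triSet (o + g • v) ((1 - g) • v) (f • u), triSet (o + v) (u - v) (f • u + (g - 1) • v)]

theorem iUnion_pieces (o u v : Plane) {f g : ℝ} (hf : 0 < f) (hg : 0 < g) (hfg : f + g < 1) :
    ⋃ k, pieces o u v f g k = triSet o u v := by
  have hf1 : 0 < 1 - f := by linarith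
  have hg1 : 0 < 1 - g := by linarith
  have hd : 0 < 1 - f - g := by linarith
  ext p
  simp only [mem_iUnion, Fin.exists_fin_succ, pieces, Matrix.cons_val_zero, Matrix.cons_val_succ,
    IsEmpty.exists_iff, or_false]
  constructor
  · rintro (⟨x, y, hx, hx', hy, hy', rfl⟩ | ⟨x, y, hx, hy, hxy, rfl⟩ | ⟨x, y, hx, hy, hxy, rfl⟩ |
      ⟨x, y, hx, hy, hxy, rfl⟩)
    · exact ⟨x * f, y * g, by positivity, by positivity, by nlinarith, by module⟩
    · exact ⟨f + x * (1 - f), y * g, by positivity, by positivity, by nlinarith, by module⟩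
    · exact ⟨y * f, g + x * (1 - g), by positivity, by positivity, by nlinarith, by module⟩
    · exact ⟨x + y * f, 1 - x - y * (1 - g), by positivity, by nlinarith, by nlinarith, by module⟩
  · rintro ⟨x, y, hx, hy, hxy, rfl⟩
    -- each piece in terms of coordinates; the lines through `e` and the two other vertices of the
    -- large triangle are `g * x + (1 - f) * y = g` and `(1 - g) * x + f * y = f`
    have in_left : f ≤ x → g * x + (1 - f) * y ≤ g →
        o + x • u + y • v ∈ triSet (o + f • u) ((1 - f) • u) (g • v) := by
      intro h1 h2
      refine ⟨(x - f) / (1 - f), y / g, div_nonneg (by linarith) hf1.le, by positivity, ?_, ?_⟩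
      · rw [div_add_div _ _ hf1.ne' hg.ne', div_le_one (by positivity)]
        nlinarith
      · rw [smul_smul, smul_smul, div_mul_cancel₀ _ hf1.ne', div_mul_cancel₀ _ hg.ne']
        module
    have in_right : g ≤ y → (1 - g) * x + f * y ≤ f →
        o + x • u + y • v ∈ triSet (o + g • v) ((1 - g) • v) (f • u) := by
      intro h1 h2
      refine ⟨(y - g) / (1 - g), x / f, div_nonneg (by linarith) hg1.le, by positivity, ?_, ?_⟩
      · rw [div_add_div _ _ hg1.ne' hf.ne', div_le_one (by positivity)]
        nlinarith
      · rw [smul_smul, smul_smul, div_mul_cancel₀ _ hg1.ne', div_mul_cancel₀ _ hf.ne']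
        module
    have in_top : g ≤ g * x + (1 - f) * y → f ≤ (1 - g) * x + f * y →
        o + x • u + y • v ∈ triSet (o + v) (u - v) (f • u + (g - 1) • v) := by
      intro h1 h2
      have e : (1 - x - y) / (1 - f - g) * (1 - f - g) = 1 - x - y := div_mul_cancel₀ _ hd.ne'
      set b := (1 - x - y) / (1 - f - g) with hb
      have hb0 : 0 ≤ b := div_nonneg (by linarith) hd.le
      have hbf : b * f ≤ x := by
        refine le_of_mul_le_mul_right ?_ hd
        linear_combination h2 + f * e
      have hbg : b * g ≤ y := by
        refine le_of_mul_le_mul_right ?_ hd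
        linear_combination h1 + g * e
      refine ⟨x - b * f, b, by linarith, hb0, by linarith, ?_⟩
      have : y = 1 - x + b * f + b * (g - 1) := by linarith
      rw [this]
      module
    have in_par : x ≤ f → y ≤ g → o + x • u + y • v ∈ parSet o (f • u) (g • v) := by
      intro h1 h2
      refine ⟨x / f, y / g, by positivity, by rwa [div_le_one hf], by positivity,
        by rwa [div_le_one hg], ?_⟩
      rw [smul_smul, smul_smul, div_mul_cancel₀ _ hf.ne', div_mul_cancel₀ _ hg.ne']
    rcases le_total (g * x + (1 - f) * y) g with h1 | h1 <;>
      rcases le_total ((1 - g) * x + f * y) f with h2 | h2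
    · rcases le_total f x with h3 | h3
      · exact Or.inr (Or.inl (in_left h3 h1))
      · rcases le_total g y with h4 | h4
        · exact Or.inr (Or.inr (Or.inl (in_right h4 h2)))
        · exact Or.inl (in_par h3 h4)
    · refine Or.inr (Or.inl (in_left ?_ h1))
      by_contra! h3
      have : g * (f - x) ≥ (1 - f) * (y - g) := by linarith
      have : f * (y - g) ≥ (1 - g) * (f - x) := by linarith
      have : (1 - f - g) * (f - x) ≤ 0 := by nlinarith
      nlinarith
    · refine Or.inr (Or.inr (Or.inl (in_right ?_ h2)))
      by_contra! h3
      have : f * (g - y) ≥ (1 - g) * (x - f) := by linarith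
      have : g * (x - f) ≥ (1 - f) * (g - y) := by linarith
      have : (1 - f - g) * (g - y) ≤ 0 := by nlinarith
      nlinarith
    · exact Or.inr (Or.inr (Or.inr (in_top h1 h2)))

theorem pairwise_disjoint_pieces (o : Plane) {u v : Plane} (h : cross u v ≠ 0) {f g : ℝ}
    (hf : 0 < f) (hg : 0 < g) (hfg : f + g < 1) :
    Pairwise fun k l => Disjoint (interior (pieces o u v f g k))
      (interior (pieces o u v f g l)) := by
  have h01 : Disjoint (interior (pieces o u v f g 0)) (interior (pieces o u v f g 1)) := by
    refine disjoint_interior_of_coord (o := o) h (a := 1) (b := 0) (k := f) (by norm_num) ?_ ?_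
    · rintro _ ⟨x, y, hx, hx', hy, hy', rfl⟩
      exact ⟨x * f, y * g, by module, by nlinarith⟩
    · rintro _ ⟨x, y, hx, hy, hxy, rfl⟩
      exact ⟨f + x * (1 - f), y * g, by module, by nlinarith⟩
  have h02 : Disjoint (interior (pieces o u v f g 0)) (interior (pieces o u v f g 2)) := by
    refine disjoint_interior_of_coord (o := o) h (a := 0) (b := 1) (k := g) (by norm_num) ?_ ?_
    · rintro _ ⟨x, y, hx, hx', hy, hy', rfl⟩
      exact ⟨x * f, y * g, by module, by nlinarith⟩
    · rintro _ ⟨x, y, hx, hy, hxy, rfl⟩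
      exact ⟨y * f, g + x * (1 - g), by module, by nlinarith⟩
  have h12 : Disjoint (interior (pieces o u v f g 2)) (interior (pieces o u v f g 1)) := by
    refine disjoint_interior_of_coord (o := o) h (a := 1) (b := 0) (k := f) (by norm_num) ?_ ?_
    · rintro _ ⟨x, y, hx, hy, hxy, rfl⟩
      exact ⟨y * f, g + x * (1 - g), by module, by nlinarith⟩
    · rintro _ ⟨x, y, hx, hy, hxy, rfl⟩
      exact ⟨f + x * (1 - f), y * g, by module, by nlinarith⟩
  have h03 : Disjoint (interior (pieces o u v f g 0)) (interior (pieces o u v f g 3)) := by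
    refine disjoint_interior_of_coord (o := o) h (a := g) (b := 1 - f) (k := g)
      (Or.inl hg.ne') ?_ ?_
    · rintro _ ⟨x, y, hx, hx', hy, hy', rfl⟩
      refine ⟨x * f, y * g, by module, ?_⟩
      have h1 : x * (f * g) ≤ 1 * (f * g) := by gcongr
      have h2 : y * (g * (1 - f)) ≤ 1 * (g * (1 - f)) := by
        have : 0 < 1 - f := by linarith
        gcongr
      linarith
    · rintro _ ⟨x, y, hx, hy, hxy, rfl⟩
      refine ⟨x + y * f, 1 - x - y * (1 - g), by module, ?_⟩
      nlinarith
  have h13 : Disjoint (interior (pieces o u v f g 1)) (interior (pieces o u v f g 3)) := by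
    refine disjoint_interior_of_coord (o := o) h (a := g) (b := 1 - f) (k := g)
      (Or.inl hg.ne') ?_ ?_
    · rintro _ ⟨x, y, hx, hy, hxy, rfl⟩
      refine ⟨f + x * (1 - f), y * g, by module, ?_⟩
      have : 0 < g * (1 - f) := mul_pos hg (by linarith)
      nlinarith
    · rintro _ ⟨x, y, hx, hy, hxy, rfl⟩
      refine ⟨x + y * f, 1 - x - y * (1 - g), by module, ?_⟩
      nlinarith
  have h23 : Disjoint (interior (pieces o u v f g 2)) (interior (pieces o u v f g 3)) := by
    refine disjoint_interior_of_coord (o := o) h (a := 1 - g) (b := f) (k := f)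
      (Or.inr hf.ne') ?_ ?_
    · rintro _ ⟨x, y, hx, hy, hxy, rfl⟩
      refine ⟨y * f, g + x * (1 - g), by module, ?_⟩
      have : 0 < f * (1 - g) := mul_pos hf (by linarith)
      nlinarith
    · rintro _ ⟨x, y, hx, hy, hxy, rfl⟩
      refine ⟨x + y * f, 1 - x - y * (1 - g), by module, ?_⟩
      nlinarith
  intro k l hkl
  fin_cases k <;> fin_cases l <;> first | exact (hkl rfl).elim | assumption | (symm; assumption)

/-! ### The tiling -/

theorem norm_sq_smul_add_smul (u v : Plane) (a b : ℝ) :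
    ‖a • u + b • v‖ ^ 2 =
      a ^ 2 * ‖u‖ ^ 2 + b ^ 2 * ‖v‖ ^ 2 + a * b * (‖u‖ ^ 2 + ‖v‖ ^ 2 - ‖u - v‖ ^ 2) := by
  simp only [EuclideanSpace.norm_sq_eq, Fin.sum_univ_two, Real.norm_eq_abs, sq_abs,
    PiLp.sub_apply, PiLp.add_apply, PiLp.smul_apply, smul_eq_mul]
  ring

/-- If the squared sides of a triangle are proportional to `1`, `t * (2 - t) ^ 2`, `(1 - t) ^ 2`
with `t = (m / k) ^ 2`, then it is tiled by a triangle with squared sides proportional to `1`,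
`t`, `(1 - t) ^ 2`. The interior point of the dissection is chosen so that the three triangles are
similar to the tile, with ratios `k ^ 2 - m ^ 2`, `m * k` and `k ^ 2 - m ^ 2`; the sides of the
parallelogram are `m ^ 2` and `k ^ 2 - m ^ 2` times sides of the tile. -/
theorem exists_tiling_of_sides (T : Tri) {m k : ℕ} (hm : 0 < m) (hmk : m < k) {L t : ℝ}
    (hL : 0 < L) (ht : t = (m / k : ℝ) ^ 2)
    (h01 : dist (T.points 0) (T.points 1) ^ 2 = L ^ 2)
    (h12 : dist (T.points 1) (T.points 2) ^ 2 = t * (2 - t) ^ 2 * L ^ 2)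
    (h02 : dist (T.points 0) (T.points 2) ^ 2 = (1 - t) ^ 2 * L ^ 2) :
    ∃ (R : Tri) (c : ℝ), 0 < c ∧ dist (R.points 0) (R.points 1) ^ 2 = c ^ 2 ∧
      dist (R.points 1) (R.points 2) ^ 2 = t * c ^ 2 ∧
      dist (R.points 0) (R.points 2) ^ 2 = (1 - t) ^ 2 * c ^ 2 ∧ TiledBy R (region T) := by
  have hk : 0 < k := hm.trans hmk
  have hm' : (0 : ℝ) < m := by exact_mod_cast hm
  have hk' : (0 : ℝ) < k := by exact_mod_cast hk
  have hmk' : (m : ℝ) < k := by exact_mod_cast hmk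
  have ht0 : 0 < t := by rw [ht]; positivity
  have hx : 0 < k ^ 2 - m ^ 2 := Nat.sub_pos_of_lt (Nat.pow_lt_pow_left hmk two_ne_zero)
  obtain ⟨x, hxdef⟩ : ∃ x : ℕ, x = k ^ 2 - m ^ 2 := ⟨_, rfl⟩
  rw [← hxdef] at hx
  have hx' : (0 : ℝ) < x := by exact_mod_cast hx
  have hxe : (x : ℝ) = k ^ 2 - m ^ 2 := by
    have : m ^ 2 ≤ k ^ 2 := Nat.pow_le_pow_left hmk.le 2
    rw [hxdef]
    push_cast [this]
    rfl
  have htx : (1 - t) * k ^ 2 = x := by rw [ht, hxe]; field_simp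
  have htm : t * k ^ 2 = m ^ 2 := by rw [ht]; field_simp
  have ht1 : 0 < 1 - t := by
    by_contra! h
    nlinarith [sq_nonneg (k : ℝ)]
  have ht2 : 0 < 2 - t := by linarith
  set u := T.points 0 - T.points 1 with hu
  set v := T.points 2 - T.points 1 with hv
  have hcr : cross u v ≠ 0 := cross_ne_zero T
  have nu : ‖u‖ ^ 2 = L ^ 2 := by rw [hu, ← dist_eq_norm, h01]
  have nv : ‖v‖ ^ 2 = t * (2 - t) ^ 2 * L ^ 2 := by rw [hv, ← dist_eq_norm, dist_comm, h12]
  have nuv : ‖u - v‖ ^ 2 = (1 - t) ^ 2 * L ^ 2 := by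
    rw [hu, hv, sub_sub_sub_cancel_right, ← dist_eq_norm, h02]
  have key : ∀ a b : ℝ, ‖a • u + b • v‖ ^ 2 = (a ^ 2 + b ^ 2 * (t * (2 - t) ^ 2) +
      a * b * (1 + t * (2 - t) ^ 2 - (1 - t) ^ 2)) * L ^ 2 := by
    intro a b
    rw [norm_sq_smul_add_smul, nu, nv, nuv]
    ring
  set c : ℝ := L / k ^ 2 with hc
  have hc0 : 0 < c := by positivity
  have hLc : L = k ^ 2 * c := by rw [hc]; field_simp
  set g : ℝ := (1 - t) / (2 - t) with hg
  have hg0 : 0 < g := div_pos ht1 ht2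
  have hgt : g * (2 - t) = 1 - t := div_mul_cancel₀ _ ht2.ne'
  have htg : t + g < 1 := by
    by_contra! h
    nlinarith
  -- it suffices to compare squared lengths
  have spans : ∀ {R : Tri}, dist (R.points 0) (R.points 1) ^ 2 = c ^ 2 →
      dist (R.points 1) (R.points 2) ^ 2 = t * c ^ 2 →
      dist (R.points 0) (R.points 2) ^ 2 = (1 - t) ^ 2 * c ^ 2 →
      ∀ {u' v' : Plane}, ‖u'‖ ^ 2 = c ^ 2 → ‖v'‖ ^ 2 = t * c ^ 2 →
        ‖u' - v'‖ ^ 2 = (1 - t) ^ 2 * c ^ 2 → SpansTile R u' v' := by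
    intro R r1 r2 r3 u' v' e1 e2 e3
    refine ⟨?_, ?_, ?_⟩
    · exact (pow_left_inj₀ (norm_nonneg _) dist_nonneg two_ne_zero).1 (e1.trans r1.symm)
    · exact (pow_left_inj₀ (norm_nonneg _) dist_nonneg two_ne_zero).1 (e2.trans r2.symm)
    · exact (pow_left_inj₀ (norm_nonneg _) dist_nonneg two_ne_zero).1 (e3.trans r3.symm)
  -- the triangle on the first side of the parallelogram
  set u₁ : Plane := (1 / k ^ 2 : ℝ) • u with hu₁
  set v₁ : Plane := (g / x) • v with hv₁
  have hgx : g / x * (2 - t) = 1 / k ^ 2 := by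
    rw [div_mul_eq_mul_div, hgt, ← htx]
    field_simp
  have n₁ : ‖u₁‖ ^ 2 = c ^ 2 := by
    have := key (1 / k ^ 2) 0
    rw [zero_smul, add_zero] at this
    rw [this, hLc]
    field_simp
    ring
  have n₂ : ‖v₁‖ ^ 2 = t * c ^ 2 := by
    have := key 0 (g / x)
    rw [zero_smul, zero_add] at this
    rw [this, hLc]
    have e : (g / x) ^ 2 * (t * (2 - t) ^ 2) = t * (1 / k ^ 2) ^ 2 := by rw [← hgx]; ring
    rw [zero_mul, zero_mul, zero_pow two_ne_zero, zero_add, add_zero, e]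
    field_simp
  have n₃ : ‖u₁ - v₁‖ ^ 2 = (1 - t) ^ 2 * c ^ 2 := by
    have := key (1 / k ^ 2) (-(g / x))
    rw [neg_smul, ← sub_eq_add_neg] at this
    rw [this, hLc, ← hgx]
    have hk4 : (k : ℝ) ^ 2 * (g / x * (2 - t)) = 1 := by rw [hgx]; field_simp
    generalize g / x = r at *
    linear_combination (1 - t) ^ 2 * c ^ 2 * (k ^ 2 * (r * (2 - t)) + 1) * hk4
  let R : Tri := ⟨![u₁, 0, v₁], by
    rw [affineIndependent_iff_cross]
    simp only [Matrix.cons_val_zero, Matrix.cons_val_one, Matrix.cons_val, sub_zero]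
    rw [hu₁, hv₁, cross_smul_left, cross_smul_right]
    have : g / x ≠ 0 := by positivity
    positivity⟩
  have r01 : dist (R.points 0) (R.points 1) ^ 2 = c ^ 2 := by
    simp [R, n₁]
  have r12 : dist (R.points 1) (R.points 2) ^ 2 = t * c ^ 2 := by
    simp [R, n₂]
  have r02 : dist (R.points 0) (R.points 2) ^ 2 = (1 - t) ^ 2 * c ^ 2 := by
    simp [R, dist_eq_norm, n₃]
  have s₁ : SpansTile R u₁ v₁ := spans r01 r12 r02 n₁ n₂ n₃
  -- the triangle on the second side of the parallelogram
  have hg1 : (1 - g) * (2 - t) = 1 := by linear_combination -hgt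
  have hmk0 : (m * k : ℝ) ≠ 0 := by positivity
  have s₂ : SpansTile R (((1 - g) / (m * k)) • v) ((t / (m * k)) • u) := by
    have q : (1 / (m * k) : ℝ) ^ 2 * t * k ^ 4 = 1 := by
      rw [ht]
      field_simp
    rw [div_eq_mul_one_div (1 - g), div_eq_mul_one_div t]
    generalize (1 / (m * k) : ℝ) = r at q ⊢
    refine spans r01 r12 r02 ?_ ?_ ?_
    · have := key 0 ((1 - g) * r)
      rw [zero_smul, zero_add] at this
      rw [this, hLc]
      linear_combination (1 - g) ^ 2 * (2 - t) ^ 2 * c ^ 2 * q +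
        c ^ 2 * ((1 - g) * (2 - t) + 1) * hg1
    · have := key (t * r) 0
      rw [zero_smul, add_zero] at this
      rw [this, hLc]
      linear_combination t * c ^ 2 * q
    · have := key (-(t * r)) ((1 - g) * r)
      rw [neg_smul, neg_add_eq_sub] at this
      rw [this, hLc]
      linear_combination (t + (1 - g) ^ 2 * (2 - t) ^ 2 - (1 - g) * (2 - t) * (3 * t - t ^ 2)) *
        c ^ 2 * q + c ^ 2 * ((1 - g) * (2 - t) + 1 - (3 * t - t ^ 2)) * hg1
  -- the triangle opposite to the parallelogram
  have s₃ : SpansTile R ((1 / x : ℝ) • (u - v)) ((1 / x : ℝ) • (t • u + (g - 1) • v)) := by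
    have q : (1 / x : ℝ) * ((1 - t) * k ^ 2) = 1 := by
      rw [htx]
      field_simp
    generalize (1 / x : ℝ) = r at q ⊢
    refine spans r01 r12 r02 ?_ ?_ ?_
    · have := key r (-r)
      rw [neg_smul, ← sub_eq_add_neg, ← smul_sub] at this
      rw [this, hLc]
      linear_combination c ^ 2 * (r * ((1 - t) * k ^ 2) + 1) * q
    · have := key (r * t) (r * (g - 1))
      rw [mul_smul, mul_smul, ← smul_add] at this
      rw [this, hLc]
      linear_combination t * c ^ 2 * (r * ((1 - t) * k ^ 2) + 1) * q +
        r ^ 2 * k ^ 4 * c ^ 2 * t * ((1 - g) * (2 - t) + 1 - t * (3 - t)) * hg1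
    · have := key (r * (1 - t)) (-(r * g))
      have e : r • (u - v) - r • (t • u + (g - 1) • v) =
        (r * (1 - t)) • u + (-(r * g)) • v := by module
      rw [e, this, hLc]
      linear_combination (1 - t) ^ 2 * c ^ 2 * (r * ((1 - t) * k ^ 2) + 1) * q +
        r ^ 2 * k ^ 4 * c ^ 2 * t * (g * (2 - t) + (1 - t) - (1 - t) * (3 - t)) * hgt
  refine ⟨R, c, hc0, r01, r12, r02, ?_⟩
  rw [region_eq_triSet, ← iUnion_pieces _ _ _ ht0 hg0 htg]
  refine TiledBy.iUnion (fun l => ?_) (pairwise_disjoint_pieces _ hcr ht0 hg0 htg)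
  have ex : (x : ℝ) ≠ 0 := hx'.ne'
  have ev : g • v = (x : ℝ) • v₁ := by
    rw [hv₁, smul_smul, mul_div_cancel₀ _ ex]
  have eu : t • u = ((m ^ 2 : ℕ) : ℝ) • u₁ := by
    rw [hu₁, smul_smul, Nat.cast_pow, ← htm]
    congr 1
    field_simp
  have eu' : (1 - t) • u = (x : ℝ) • u₁ := by
    rw [hu₁, smul_smul, ← htx]
    congr 1
    field_simp
  fin_cases l
  · change TiledBy R (parSet (T.points 1) (t • u) (g • v))
    rw [eu, ev]
    exact s₁.tiledBy_parSet_nsmul (by positivity) hx _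
  · change TiledBy R (triSet (T.points 1 + t • u) ((1 - t) • u) (g • v))
    rw [eu', ev]
    exact s₁.tiledBy_triSet_nsmul hx _
  · change TiledBy R (triSet (T.points 1 + g • v) ((1 - g) • v) (t • u))
    have := s₂.tiledBy_triSet_nsmul (n := m * k) (by positivity) (T.points 1 + g • v)
    rwa [Nat.cast_mul, smul_smul, smul_smul, mul_div_cancel₀ _ hmk0, mul_div_cancel₀ _ hmk0] at this
  · change TiledBy R (triSet (T.points 1 + v) (u - v) (t • u + (g - 1) • v))
    have := s₃.tiledBy_triSet_nsmul hx (T.points 1 + v)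
    rwa [smul_smul, smul_smul, mul_one_div_cancel ex, one_smul, one_smul] at this

/-! ### Side ratios from angles -/

theorem angleAt_pos (S : Tri) (i : Fin 3) : 0 < angleAt S i := by
  have h : ¬ Collinear ℝ {S.points (i + 1), S.points i, S.points (i + 2)} := by
    have := affineIndependent_iff_not_collinear.1 S.independent
    convert! this using 2
    ext p
    simp only [mem_insert_iff, mem_singleton_iff, mem_range]
    constructor
    · rintro (h | h | h) <;> exact ⟨_, h.symm⟩
    · rintro ⟨j, rfl⟩
      fin_cases i <;> fin_cases j <;> simp
  exact EuclideanGeometry.angle_pos_of_not_collinear h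

theorem angleAt_sum (S : Tri) : angleAt S 0 + angleAt S 1 + angleAt S 2 = Real.pi := by
  have h01 : S.points 1 ≠ S.points 0 := S.independent.injective.ne (by decide)
  have := EuclideanGeometry.angle_add_angle_add_angle_eq_pi (S.points 2) h01
  change EuclideanGeometry.angle (S.points 1) (S.points 0) (S.points 2) +
    EuclideanGeometry.angle (S.points 2) (S.points 1) (S.points 0) +
    EuclideanGeometry.angle (S.points 0) (S.points 2) (S.points 1) = Real.pi
  rw [EuclideanGeometry.angle_comm (S.points 2) (S.points 1),
    EuclideanGeometry.angle_comm (S.points 0) (S.points 2),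
    EuclideanGeometry.angle_comm (S.points 1) (S.points 0)]
  linarith

/-- The law of sines, in terms of the angles at the vertices `0` and `1`. -/
theorem exists_sides_eq_mul_sin (S : Tri) :
    ∃ r : ℝ, 0 < r ∧ dist (S.points 1) (S.points 2) = r * Real.sin (angleAt S 0) ∧
      dist (S.points 0) (S.points 2) = r * Real.sin (angleAt S 1) ∧
      dist (S.points 0) (S.points 1) = r * Real.sin (angleAt S 0 + angleAt S 1) := by
  have hsum := angleAt_sum S
  have h0 := angleAt_pos S 0
  have h1 := angleAt_pos S 1
  have h2 := angleAt_pos S 2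
  have hs : 0 < Real.sin (angleAt S 0) := Real.sin_pos_of_pos_of_lt_pi h0 (by linarith)
  have hd : 0 < dist (S.points 1) (S.points 2) :=
    dist_pos.2 (S.independent.injective.ne (by decide))
  have e2 : angleAt S 0 + angleAt S 1 = Real.pi - angleAt S 2 := by linarith
  have l1 := EuclideanGeometry.law_sin (S.points 0) (S.points 1) (S.points 2)
  have l2 := EuclideanGeometry.law_sin (S.points 0) (S.points 2) (S.points 1)
  have a0 : EuclideanGeometry.angle (S.points 1) (S.points 0) (S.points 2) = angleAt S 0 := rfl
  have a1 : EuclideanGeometry.angle (S.points 2) (S.points 1) (S.points 0) = angleAt S 1 := rfl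
  have a2 : EuclideanGeometry.angle (S.points 0) (S.points 2) (S.points 1) = angleAt S 2 := rfl
  rw [EuclideanGeometry.angle_comm, a1, EuclideanGeometry.angle_comm, a0] at l1
  rw [a2, a0, dist_comm (S.points 2), dist_comm _ (S.points 0)] at l2
  refine ⟨dist (S.points 1) (S.points 2) / Real.sin (angleAt S 0), by positivity, ?_, ?_, ?_⟩
  · field_simp
  · rw [dist_comm (S.points 2) (S.points 0)] at l1
    field_simp
    linarith
  · rw [e2, Real.sin_pi_sub]
    field_simp
    linarith

theorem cos_three_mul_eq (θ : ℝ) :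
    Real.cos (3 * θ) = (1 - (2 * Real.sin θ) ^ 2) * Real.cos θ := by
  rw [Real.cos_three_mul]
  linear_combination 4 * Real.cos θ * Real.sin_sq_add_cos_sq θ

theorem sin_four_mul_eq (θ : ℝ) :
    Real.sin (4 * θ) =
      2 * Real.sin θ * (2 - (2 * Real.sin θ) ^ 2) * Real.cos θ := by
  rw [show 4 * θ = 2 * (2 * θ) by ring, Real.sin_two_mul, Real.sin_two_mul, Real.cos_two_mul]
  linear_combination 8 * Real.sin θ * Real.cos θ * Real.sin_sq_add_cos_sq θ

/-- Side ratios of a triangle with angles `2 * θ` and `π / 2 - 3 * θ`. -/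
theorem tile_sides {S : Tri} {θ : ℝ} (h0 : angleAt S 0 = 2 * θ)
    (h1 : angleAt S 1 = Real.pi / 2 - 3 * θ) :
    dist (S.points 1) (S.points 2) = 2 * Real.sin θ * dist (S.points 0) (S.points 1) ∧
      dist (S.points 0) (S.points 2) =
        (1 - (2 * Real.sin θ) ^ 2) * dist (S.points 0) (S.points 1) := by
  obtain ⟨r, -, e12, e02, e01⟩ := exists_sides_eq_mul_sin S
  rw [h0, h1, show 2 * θ + (Real.pi / 2 - 3 * θ) = Real.pi / 2 - θ by ring,
    Real.sin_pi_div_two_sub] at e01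
  rw [h0, Real.sin_two_mul] at e12
  rw [h1, Real.sin_pi_div_two_sub, cos_three_mul_eq] at e02
  constructor
  · rw [e12, e01]; ring
  · rw [e02, e01]; ring

/-- Side ratios of a triangle with angles `4 * θ` and `π / 2 - 3 * θ`. -/
theorem tiled_sides {S : Tri} {θ : ℝ} (h0 : angleAt S 0 = 4 * θ)
    (h1 : angleAt S 1 = Real.pi / 2 - 3 * θ) :
    dist (S.points 1) (S.points 2) =
        2 * Real.sin θ * (2 - (2 * Real.sin θ) ^ 2) * dist (S.points 0) (S.points 1) ∧
      dist (S.points 0) (S.points 2) =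
        (1 - (2 * Real.sin θ) ^ 2) * dist (S.points 0) (S.points 1) := by
  obtain ⟨r, -, e12, e02, e01⟩ := exists_sides_eq_mul_sin S
  rw [h0, h1, show 4 * θ + (Real.pi / 2 - 3 * θ) = θ + Real.pi / 2 by ring,
    Real.sin_add_pi_div_two] at e01
  rw [h0, sin_four_mul_eq] at e12
  rw [h1, Real.sin_pi_div_two_sub, cos_three_mul_eq] at e02
  constructor
  · rw [e12, e01]; ring
  · rw [e02, e01]; ring

/-- The side ratios in `tile_sides` determine the angles. -/
theorem tile_angles {S : Tri} {θ c : ℝ} (hθ : 0 < θ) (hθ' : 6 * θ < Real.pi) (hc : 0 < c)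
    (h01 : dist (S.points 0) (S.points 1) ^ 2 = c ^ 2)
    (h12 : dist (S.points 1) (S.points 2) ^ 2 = (2 * Real.sin θ) ^ 2 * c ^ 2)
    (h02 : dist (S.points 0) (S.points 2) ^ 2 = (1 - (2 * Real.sin θ) ^ 2) ^ 2 * c ^ 2) :
    angleAt S 0 = 2 * θ ∧ angleAt S 1 = Real.pi / 2 - 3 * θ := by
  have hs : 0 < 2 * Real.sin θ := by
    have := Real.sin_pos_of_pos_of_lt_pi hθ (by linarith)
    positivity
  have hs1 : 2 * Real.sin θ < 1 := by
    have : Real.sin θ < Real.sin (Real.pi / 6) :=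
      Real.sin_lt_sin_of_lt_of_le_pi_div_two (by linarith) (by linarith) (by linarith)
    rw [Real.sin_pi_div_six] at this
    linarith
  have ht1 : 0 < 1 - (2 * Real.sin θ) ^ 2 := by nlinarith
  have d01 : dist (S.points 0) (S.points 1) = c :=
    (pow_left_inj₀ dist_nonneg hc.le two_ne_zero).1 h01
  have d12 : dist (S.points 1) (S.points 2) = 2 * Real.sin θ * c := by
    rw [← mul_pow] at h12
    exact (pow_left_inj₀ dist_nonneg (by positivity) two_ne_zero).1 h12
  have d02 : dist (S.points 0) (S.points 2) = (1 - (2 * Real.sin θ) ^ 2) * c := by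
    rw [← mul_pow] at h02
    exact (pow_left_inj₀ dist_nonneg (by positivity) two_ne_zero).1 h02
  have c0 := EuclideanGeometry.law_cos (S.points 1) (S.points 0) (S.points 2)
  have c1 := EuclideanGeometry.law_cos (S.points 2) (S.points 1) (S.points 0)
  rw [dist_comm (S.points 1) (S.points 0), dist_comm (S.points 2) (S.points 0), d01, d12, d02]
    at c0
  rw [dist_comm (S.points 2) (S.points 1), dist_comm (S.points 2) (S.points 0), d01, d12, d02]
    at c1
  have a0 : EuclideanGeometry.angle (S.points 1) (S.points 0) (S.points 2) = angleAt S 0 := rfl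
  have a1 : EuclideanGeometry.angle (S.points 2) (S.points 1) (S.points 0) = angleAt S 1 := rfl
  rw [a0] at c0
  rw [a1] at c1
  have hsum := angleAt_sum S
  have p0 := angleAt_pos S 0
  have p1 := angleAt_pos S 1
  have p2 := angleAt_pos S 2
  constructor
  · refine Real.injOn_cos ⟨p0.le, by linarith⟩ ⟨by linarith, by linarith⟩ ?_
    have e : Real.cos (2 * θ) = 1 - (2 * Real.sin θ) ^ 2 / 2 := by
      rw [Real.cos_two_mul]
      linear_combination 2 * Real.sin_sq_add_cos_sq θ
    rw [e]
    have hne : c * ((1 - (2 * Real.sin θ) ^ 2) * c) ≠ 0 := by positivity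
    apply mul_left_cancel₀ hne
    linear_combination c0 / 2
  · refine Real.injOn_cos ⟨p1.le, by linarith⟩ ⟨by linarith, by linarith⟩ ?_
    have e : Real.cos (Real.pi / 2 - 3 * θ) = 2 * Real.sin θ * (3 - (2 * Real.sin θ) ^ 2) / 2 := by
      rw [Real.cos_pi_div_two_sub, Real.sin_three_mul]
      ring
    rw [e]
    have hne : (2 * Real.sin θ * c) * c ≠ 0 := by positivity
    apply mul_left_cancel₀ hne
    linear_combination c1 / 2

/-! ### Areas -/

theorem volume_triSet (o u v : Plane) :
    volume (triSet o u v) = ENNReal.ofReal |cross u v| *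
      volume (triSet 0 (EuclideanSpace.single 0 1) (EuclideanSpace.single 1 1)) := by
  let L : Plane →ₗ[ℝ] Plane := Matrix.toEuclideanLin !![u 0, v 0; u 1, v 1]
  have hdet : LinearMap.det L = cross u v := by
    simp only [L, Matrix.toLpLin_eq_toLin, LinearMap.det_toLin, Matrix.det_fin_two_of, cross]
    ring
  have hL : ∀ x y : ℝ, L (x • EuclideanSpace.single 0 1 + y • EuclideanSpace.single 1 1) =
      x • u + y • v := by
    intro x y
    ext i
    fin_cases i <;> simp [L, Matrix.toLpLin_apply, dotProduct, Fin.sum_univ_two] <;>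
      ring
  rw [← hdet, ← Measure.addHaar_image_linearMap]
  have : triSet o u v = (o + ·) '' (L ''
      triSet 0 (EuclideanSpace.single 0 1) (EuclideanSpace.single 1 1)) := by
    ext p
    constructor
    · rintro ⟨x, y, hx, hy, hxy, rfl⟩
      refine ⟨_, ⟨_, ⟨x, y, hx, hy, hxy, rfl⟩, rfl⟩, ?_⟩
      simp only [zero_add]
      rw [hL, add_assoc]
    · rintro ⟨_, ⟨_, ⟨x, y, hx, hy, hxy, rfl⟩, rfl⟩, rfl⟩
      refine ⟨x, y, hx, hy, hxy, ?_⟩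
      simp only [zero_add]
      rw [hL, add_assoc]
  rw [this, image_add_left, measure_preimage_add]

/-- Twice the area of a triangle, as the absolute value of a determinant. -/
noncomputable def twiceArea (S : Tri) : ℝ :=
  |cross (S.points 0 - S.points 1) (S.points 2 - S.points 1)|

theorem twiceArea_pos (S : Tri) : 0 < twiceArea S := abs_pos.2 (cross_ne_zero S)

theorem twiceArea_sq (S : Tri) : twiceArea S ^ 2 =
    dist (S.points 0) (S.points 1) ^ 2 * dist (S.points 1) (S.points 2) ^ 2 -
      ((dist (S.points 0) (S.points 1) ^ 2 + dist (S.points 1) (S.points 2) ^ 2 -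
        dist (S.points 0) (S.points 2) ^ 2) / 2) ^ 2 := by
  rw [twiceArea, sq_abs, cross_sq, sub_sub_sub_cancel_right, ← dist_eq_norm, ← dist_eq_norm,
    ← dist_eq_norm, dist_comm (S.points 2)]

theorem twiceArea_congr {S R : Tri} (h : Congruent S.points R.points) :
    twiceArea S = twiceArea R := by
  refine (pow_left_inj₀ (abs_nonneg _) (abs_nonneg _) two_ne_zero).1 ?_
  simp only [twiceArea_sq, h.dist_eq]

theorem volume_region (S : Tri) : volume (region S) = ENNReal.ofReal (twiceArea S) *
    volume (triSet 0 (EuclideanSpace.single 0 1) (EuclideanSpace.single 1 1)) := by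
  rw [region_eq_triSet, volume_triSet, twiceArea]

theorem isCompact_region (S : Tri) : IsCompact (region S) :=
  (finite_range S.points).isCompact_convexHull ℝ

theorem aedisjoint_region {S S' : Tri}
    (h : Disjoint (interior (region S)) (interior (region S'))) :
    AEDisjoint volume (region S) (region S') := by
  have key : ∀ S : Tri, interior (region S) =ᵐ[volume] region S := fun S =>
    interior_ae_eq_of_null_frontier ((convex_convexHull ℝ (range S.points)).addHaar_frontier volume)
  exact h.aedisjoint.congr (key S).symm (key S').symm

theorem IsTiling.twiceArea_eq {T R : Tri} {N : ℕ} {t : Fin N → Tri} (h : IsTiling T R t) :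
    twiceArea T = N * twiceArea R := by
  set e := volume (triSet (0 : Plane) (EuclideanSpace.single 0 1) (EuclideanSpace.single 1 1))
    with he
  have hT := volume_region T
  have e0 : e ≠ 0 := by
    have hne : (interior (region T)).Nonempty := by
      rw [region, interior_convexHull_nonempty_iff_affineSpan_eq_top,
        T.independent.affineSpan_eq_top_iff_card_eq_finrank_add_one]
      simp
    have : 0 < volume (region T) :=
      (isOpen_interior.measure_pos volume hne).trans_le (measure_mono interior_subset)
    rw [hT] at this
    exact right_ne_zero_of_mul this.ne'
  have etop : e ≠ ⊤ := by
    intro htop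
    have := (isCompact_region T).measure_lt_top (μ := volume)
    rw [hT, ← he, htop, ENNReal.mul_top] at this
    · exact lt_irrefl _ this
    · simpa using twiceArea_pos T
  have hsum : volume (region T) = ∑ j : Fin N, volume (region (t j)) := by
    rw [← h.cover, measure_iUnion₀, tsum_fintype]
    · exact fun j k hjk => aedisjoint_region (h.disjoint j k hjk)
    · exact fun j => (isCompact_region _).isClosed.measurableSet.nullMeasurableSet
  have hj : ∀ j, volume (region (t j)) = ENNReal.ofReal (twiceArea R) * e := fun j => by
    rw [volume_region, twiceArea_congr (h.congruent j)]
  rw [hT, Finset.sum_congr rfl fun j _ => hj j, Finset.sum_const, Finset.card_univ,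
    Fintype.card_fin, nsmul_eq_mul, ← mul_assoc] at hsum
  have := (ENNReal.mul_left_inj e0 etop).1 hsum
  have := congrArg ENNReal.toReal this
  rwa [ENNReal.toReal_mul, ENNReal.toReal_natCast, ENNReal.toReal_ofReal (twiceArea_pos T).le,
    ENNReal.toReal_ofReal (twiceArea_pos R).le] at this

/-! ### A side of the tiled triangle -/

/-- The vertices of a triangle as an affine basis of the plane. -/
noncomputable def affineBasis (S : Tri) : AffineBasis (Fin 3) ℝ Plane :=
  ⟨S.points, S.independent, by
    rw [S.independent.affineSpan_eq_top_iff_card_eq_finrank_add_one]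
    simp⟩

/-- Barycentric coordinates with respect to a triangle. -/
noncomputable abbrev bary (S : Tri) (i : Fin 3) : Plane →ᵃ[ℝ] ℝ := (affineBasis S).coord i

theorem bary_apply_self (S : Tri) (i : Fin 3) : bary S i (S.points i) = 1 :=
  (affineBasis S).coord_apply_eq i

theorem bary_apply_ne (S : Tri) {i j : Fin 3} (h : i ≠ j) : bary S i (S.points j) = 0 :=
  (affineBasis S).coord_apply_ne h

theorem mem_region_iff {S : Tri} {p : Plane} : p ∈ region S ↔ ∀ i, 0 ≤ bary S i p := by
  have := (affineBasis S).convexHull_eq_nonneg_coord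
  exact (congrArg (p ∈ ·) this).to_iff

theorem mem_interior_region_iff {S : Tri} {p : Plane} :
    p ∈ interior (region S) ↔ ∀ i, 0 < bary S i p := by
  have := (affineBasis S).interior_convexHull
  exact (congrArg (p ∈ ·) this).to_iff

theorem sum_bary (S : Tri) (p : Plane) : ∑ i, bary S i p = 1 :=
  (affineBasis S).sum_coord_apply_eq_one p

theorem affineMap_eq_sum_bary (f : Plane →ᵃ[ℝ] ℝ) (S : Tri) (p : Plane) :
    f p = ∑ i, bary S i p * f (S.points i) := by
  have h := Finset.univ.map_affineCombination S.points (fun i => bary S i p) (sum_bary S p) f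
  have e : Finset.univ.affineCombination ℝ S.points (fun i => bary S i p) = p :=
    (affineBasis S).affineCombination_coord_eq_self p
  rw [e] at h
  rw [h, Finset.univ.affineCombination_eq_linear_combination _ _ (sum_bary S p)]
  rfl

theorem sum_fin_three (g : Fin 3 → ℝ) (i : Fin 3) : ∑ j, g j = g i + g (i + 1) + g (i + 2) := by
  rw [Fin.sum_univ_three]
  fin_cases i
  · rfl
  · change g 0 + g 1 + g 2 = g 1 + g 2 + g 0
    ring
  · change g 0 + g 1 + g 2 = g 2 + g 0 + g 1
    ring

theorem forall_fin_three {P : Fin 3 → Prop} (i : Fin 3) (h0 : P i) (h1 : P (i + 1))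
    (h2 : P (i + 2)) (j : Fin 3) : P j := by
  have key : ∀ i j : Fin 3, j = i ∨ j = i + 1 ∨ j = i + 2 := by decide
  rcases key i j with rfl | rfl | rfl <;> assumption

/-- The side of `T` from vertex `0` to vertex `1`, parametrized by `[0, 1]`. -/
noncomputable abbrev side (T : Tri) : ℝ →ᵃ[ℝ] Plane :=
  AffineMap.lineMap (T.points 0) (T.points 1)

theorem bary_side (T : Tri) (i : Fin 3) (x : ℝ) :
    bary T i (side T x) = (1 - x) * bary T i (T.points 0) + x * bary T i (T.points 1) := by
  rw [side, AffineMap.apply_lineMap, AffineMap.lineMap_apply_ring]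

theorem bary_zero_side (T : Tri) (x : ℝ) : bary T 0 (side T x) = 1 - x := by
  rw [bary_side, bary_apply_self, bary_apply_ne T (by decide)]
  ring

theorem bary_one_side (T : Tri) (x : ℝ) : bary T 1 (side T x) = x := by
  rw [bary_side, bary_apply_self, bary_apply_ne T (by decide)]
  ring

theorem bary_two_side (T : Tri) (x : ℝ) : bary T 2 (side T x) = 0 := by
  rw [bary_side, bary_apply_ne T (by decide), bary_apply_ne T (by decide)]
  ring

theorem ext_bary (S : Tri) {p q : Plane} (h : ∀ i, bary S i p = bary S i q) : p = q :=
  (affineBasis S).ext_elem h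

theorem eq_side_of_bary_two_eq_zero {T : Tri} {p : Plane} (h : bary T 2 p = 0) :
    p = side T (bary T 1 p) := by
  refine ext_bary T (forall_fin_three 0 ?_ ?_ ?_)
  · have := sum_bary T p
    rw [Fin.sum_univ_three, h] at this
    rw [bary_zero_side]
    linarith
  · exact (bary_one_side T _).symm
  · exact h.trans (bary_two_side T _).symm

theorem preimage_side_region (T : Tri) : side T ⁻¹' region T = Icc 0 1 := by
  ext x
  rw [mem_preimage, mem_region_iff]
  constructor
  · intro h
    have h0 := h 0
    have h1 := h 1
    rw [bary_zero_side] at h0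
    rw [bary_one_side] at h1
    exact ⟨h1, by linarith⟩
  · rintro ⟨h0, h1⟩
    refine forall_fin_three 0 ?_ ?_ ?_
    · rw [bary_zero_side]
      linarith
    · exact h0.trans_eq (bary_one_side T x).symm
    · exact (bary_two_side T x).ge

theorem continuous_bary (S : Tri) (i : Fin 3) : Continuous (bary S i) :=
  AffineMap.continuous_of_finiteDimensional _

/-- A triangle `S` inside `T` meets a side of `T` in a set whose length is that of a side of `S`,
or zero (a vertex or nothing). From all but finitely many points of this set, one enters the
interior of `S` when moving parallel to another side of `T`. -/
theorem exists_trace {S T : Tri} (h : region S ⊆ region T) :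
    (∃ E : Set ℝ, E.Finite ∧ ∀ x ∈ side T ⁻¹' region S, x ∉ E →
      ∀ᶠ ε : ℝ in 𝓝[>] 0, side T x + ε • (T.points 2 - T.points 0) ∈ interior (region S)) ∧
    ∃ i k, volume (side T ⁻¹' region S) =
      ENNReal.ofReal (dist (S.points i) (S.points k) / dist (T.points 0) (T.points 1)) := by
  have hv : ∀ i, S.points i ∈ region S := fun i => subset_convexHull ℝ _ (mem_range_self i)
  have hf : ∀ i, 0 ≤ bary T 2 (S.points i) := fun i => mem_region_iff.1 (h (hv i)) 2
  have hz : ∀ x ∈ side T ⁻¹' region S, ∀ i, bary S i (side T x) * bary T 2 (S.points i) = 0 := by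
    intro x hx
    have hsum := affineMap_eq_sum_bary (bary T 2) S (side T x)
    rw [bary_two_side] at hsum
    have := (Finset.sum_eq_zero_iff_of_nonneg fun i _ =>
      mul_nonneg (mem_region_iff.1 hx i) (hf i)).1 hsum.symm
    exact fun i => this i (Finset.mem_univ i)
  by_cases hedge : ∃ i, bary T 2 (S.points (i + 1)) = 0 ∧ bary T 2 (S.points (i + 2)) = 0
  · obtain ⟨i, h1, h2⟩ := hedge
    have hfi : ∀ p, bary T 2 p = bary S i p * bary T 2 (S.points i) := by
      intro p
      have := affineMap_eq_sum_bary (bary T 2) S p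
      rw [sum_fin_three _ i, h1, h2] at this
      linarith
    have hpos : 0 < bary T 2 (S.points i) := by
      refine (hf i).lt_of_ne' fun h0 => ?_
      have := hfi (T.points 2)
      rw [bary_apply_self, h0, mul_zero] at this
      exact one_ne_zero this
    set x₁ := bary T 1 (S.points (i + 1)) with hx₁
    set x₂ := bary T 1 (S.points (i + 2)) with hx₂
    have e₁ : S.points (i + 1) = side T x₁ := eq_side_of_bary_two_eq_zero h1
    have e₂ : S.points (i + 2) = side T x₂ := eq_side_of_bary_two_eq_zero h2
    have hx : ∀ x ∈ side T ⁻¹' region S, bary S (i + 1) (side T x) + bary S (i + 2) (side T x) = 1 ∧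
        bary S (i + 1) (side T x) * x₁ + bary S (i + 2) (side T x) * x₂ = x := by
      intro x hx
      have h0 : bary S i (side T x) = 0 := (mul_eq_zero.1 (hz x hx i)).resolve_right hpos.ne'
      have s1 := sum_bary S (side T x)
      have s2 := affineMap_eq_sum_bary (bary T 1) S (side T x)
      rw [sum_fin_three _ i, h0] at s1 s2
      rw [bary_one_side] at s2
      exact ⟨by linarith, by linarith⟩
    refine ⟨⟨{x₁, x₂}, by simp, ?_⟩, i + 1, i + 2, ?_⟩
    · intro x hxI hxE
      simp only [mem_insert_iff, mem_singleton_iff, not_or] at hxE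
      obtain ⟨s1, s2⟩ := hx x hxI
      have hc : Continuous fun ε : ℝ => side T x + ε • (T.points 2 - T.points 0) := by fun_prop
      have hev : ∀ j, 0 < bary S j (side T x) →
          ∀ᶠ ε : ℝ in 𝓝[>] 0, 0 < bary S j (side T x + ε • (T.points 2 - T.points 0)) := by
        intro j hj
        have ht := (((continuous_bary S j).comp hc).tendsto 0).mono_left
          (nhdsWithin_le_nhds (s := Ioi 0))
        simp only [Function.comp_apply, zero_smul, add_zero] at ht
        exact ht.eventually (lt_mem_nhds hj)
      have p1 : 0 < bary S (i + 1) (side T x) := by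
        refine (mem_region_iff.1 hxI _).lt_of_ne' fun h0 => hxE.2 ?_
        rw [h0] at s1 s2
        rw [← s2, show bary S (i + 2) (side T x) = 1 by linarith]
        ring
      have p2 : 0 < bary S (i + 2) (side T x) := by
        refine (mem_region_iff.1 hxI _).lt_of_ne' fun h0 => hxE.1 ?_
        rw [h0] at s1 s2
        rw [← s2, show bary S (i + 1) (side T x) = 1 by linarith]
        ring
      filter_upwards [hev _ p1, hev _ p2, self_mem_nhdsWithin] with ε h1 h2 hε
      refine mem_interior_region_iff.2 (forall_fin_three i ?_ h1 h2)
      have hε : 0 < ε := hε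
      -- the barycentric coordinate of `T` that vanishes on the side grows at unit speed
      have hval : bary T 2 (side T x + ε • (T.points 2 - T.points 0)) = ε := by
        rw [add_comm, ← vadd_eq_add, AffineMap.map_vadd, bary_two_side, map_smul,
          ← vsub_eq_sub (T.points 2), AffineMap.linearMap_vsub, bary_apply_self,
          bary_apply_ne T (by decide)]
        simp
      have hprod := hε.trans_eq (hval.symm.trans (hfi _))
      exact pos_of_mul_pos_left hprod hpos.le
    · have hI : side T ⁻¹' region S = uIcc x₁ x₂ := by
        rw [← segment_eq_uIcc]
        apply Subset.antisymm
        · intro x hxI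
          obtain ⟨s1, s2⟩ := hx x hxI
          exact ⟨_, _, mem_region_iff.1 hxI _, mem_region_iff.1 hxI _, s1, s2⟩
        · rintro x hx
          have := mem_image_of_mem (side T) hx
          rw [image_segment, ← e₁, ← e₂] at this
          exact (convex_convexHull ℝ _).segment_subset (hv _) (hv _) this
      have hT : 0 < dist (T.points 0) (T.points 1) :=
        dist_pos.2 (T.independent.injective.ne (by decide))
      rw [hI, Real.volume_interval, e₁, e₂, dist_lineMap_lineMap, mul_div_cancel_right₀ _ hT.ne',
        dist_comm, Real.dist_eq]
  · push Not at hedge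
    -- two vertices of `S` are off the side, so only the third one can be on it
    obtain ⟨i, h1, h2⟩ : ∃ i, bary T 2 (S.points (i + 1)) ≠ 0 ∧ bary T 2 (S.points (i + 2)) ≠ 0 := by
      have a0 := hedge 0
      have a1 := hedge 1
      have a2 := hedge 2
      by_contra! hcon
      have b0 := hcon 0
      have b1 := hcon 1
      have b2 := hcon 2
      simp only [Fin.reduceAdd] at a0 a1 a2 b0 b1 b2
      tauto
    have hsub : (side T ⁻¹' region S).Subsingleton := by
      have key : ∀ x ∈ side T ⁻¹' region S, x = bary T 1 (S.points i) := by
        intro x hx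
        have z1 : bary S (i + 1) (side T x) = 0 := (mul_eq_zero.1 (hz x hx _)).resolve_right h1
        have z2 : bary S (i + 2) (side T x) = 0 := (mul_eq_zero.1 (hz x hx _)).resolve_right h2
        have s1 := sum_bary S (side T x)
        have s2 := affineMap_eq_sum_bary (bary T 1) S (side T x)
        rw [sum_fin_three _ i, z1, z2] at s1 s2
        rw [bary_one_side, show bary S i (side T x) = 1 by linarith] at s2
        linarith
      exact fun x hx y hy => (key x hx).trans (key y hy).symm
    refine ⟨⟨_, hsub.finite, fun x hx hxE => (hxE hx).elim⟩, 0, 0, ?_⟩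
    rw [dist_self, zero_div, ENNReal.ofReal_zero, hsub.measure_zero]

/-- In a tiling, a side of the tiled triangle is a sum of sides of the tile. -/
theorem IsTiling.exists_dist_eq_sum {T R : Tri} {N : ℕ} {t : Fin N → Tri} (h : IsTiling T R t) :
    ∃ i k : Fin N → Fin 3,
      dist (T.points 0) (T.points 1) = ∑ j, dist (R.points (i j)) (R.points (k j)) := by
  have hsub : ∀ j, region (t j) ⊆ region T := fun j =>
    (subset_iUnion (fun j => region (t j)) j).trans h.cover.subset
  choose hE i k hik using fun j => exists_trace (hsub j)
  choose E hfin hE using hE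
  have hT : 0 < dist (T.points 0) (T.points 1) :=
    dist_pos.2 (T.independent.injective.ne (by decide))
  have hcont : Continuous (side T) := AffineMap.lineMap_continuous
  have hvol : volume (Icc (0 : ℝ) 1) = ∑ j, volume (side T ⁻¹' region (t j)) := by
    rw [← preimage_side_region T, ← h.cover, preimage_iUnion, measure_iUnion₀, tsum_fintype]
    · intro j l hjl
      -- a common point outside the exceptional sets would lead to common interior points
      refine measure_mono_null (t := E j ∪ E l) ?_ (((hfin j).union (hfin l)).measure_zero _)
      rintro x ⟨hxj, hxl⟩
      by_contra hx
      rw [mem_union, not_or] at hx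
      obtain ⟨ε, h1, h2⟩ := ((hE j x hxj hx.1).and (hE l x hxl hx.2)).exists
      exact Set.disjoint_left.1 (h.disjoint j l hjl) h1 h2
    · exact fun j => ((isCompact_region _).isClosed.preimage hcont).measurableSet.nullMeasurableSet
  refine ⟨i, k, ?_⟩
  have hnn : ∀ j ∈ Finset.univ, 0 ≤ dist ((t j).points (i j)) ((t j).points (k j)) /
      dist (T.points 0) (T.points 1) := fun j _ => by positivity
  rw [Finset.sum_congr rfl fun j _ => hik j, ← ENNReal.ofReal_sum_of_nonneg hnn, Real.volume_Icc,
    ENNReal.ofReal_eq_ofReal_iff (by norm_num) (Finset.sum_nonneg hnn), ← Finset.sum_div,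
    sub_zero, eq_div_iff hT.ne', one_mul] at hvol
  rw [hvol]
  exact Finset.sum_congr rfl fun j _ => (h.congruent j).dist_eq _ _

/-! ### The number of tiles -/

theorem dist_eq_rat_mul {R : Tri} {q : ℚ}
    (h12 : dist (R.points 1) (R.points 2) = q * dist (R.points 0) (R.points 1))
    (h02 : dist (R.points 0) (R.points 2) = (1 - (q : ℝ) ^ 2) * dist (R.points 0) (R.points 1))
    (i k : Fin 3) :
    ∃ r : ℚ, dist (R.points i) (R.points k) = r * dist (R.points 0) (R.points 1) := by
  have h02' : dist (R.points 0) (R.points 2) =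
      ((1 - q ^ 2 : ℚ) : ℝ) * dist (R.points 0) (R.points 1) := by
    push_cast
    exact h02
  fin_cases i <;> fin_cases k
  · exact ⟨0, by simp⟩
  · exact ⟨1, by simp⟩
  · exact ⟨_, h02'⟩
  · exact ⟨1, by simp [dist_comm (R.points 1) (R.points 0)]⟩
  · exact ⟨0, by simp⟩
  · exact ⟨_, h12⟩
  · exact ⟨_, (dist_comm _ _).trans h02'⟩
  · exact ⟨_, (dist_comm _ _).trans h12⟩
  · exact ⟨0, by simp⟩

/-- If the sides of the tile and of the tiled triangle are in the ratios found above, with a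
rational parameter `q`, then the number of tiles is `2 - q ^ 2` up to a rational square: one side
of the tiled triangle is a rational multiple of the corresponding side of the tile. -/
theorem IsTiling.exists_card_eq {T R : Tri} {N : ℕ} {t : Fin N → Tri} (h : IsTiling T R t)
    {q : ℚ}
    (h12 : dist (R.points 1) (R.points 2) = q * dist (R.points 0) (R.points 1))
    (h02 : dist (R.points 0) (R.points 2) = (1 - (q : ℝ) ^ 2) * dist (R.points 0) (R.points 1))
    (h12' : dist (T.points 1) (T.points 2) =
      q * (2 - (q : ℝ) ^ 2) * dist (T.points 0) (T.points 1))
    (h02' : dist (T.points 0) (T.points 2) = (1 - (q : ℝ) ^ 2) * dist (T.points 0) (T.points 1))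
    (hq : (q : ℝ) ^ 2 ≤ 2) :
    ∃ r : ℚ, r ≠ 0 ∧ (N : ℚ) = r ^ 2 * (2 - q ^ 2) := by
  obtain ⟨i, k, hsum⟩ := h.exists_dist_eq_sum
  choose r hr using fun j => dist_eq_rat_mul h12 h02 (i j) (k j)
  have hR := twiceArea_sq R
  have hT := twiceArea_sq T
  have hRpos := twiceArea_pos R
  have hdT : 0 < dist (T.points 0) (T.points 1) :=
    dist_pos.2 (T.independent.injective.ne (by decide))
  rw [Finset.sum_congr rfl fun j _ => hr j, ← Finset.sum_mul, ← Rat.cast_sum] at hsum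
  rw [h.twiceArea_eq, h12', h02'] at hT
  rw [h12, h02] at hR
  have hdR : 0 < dist (R.points 0) (R.points 1) :=
    dist_pos.2 (R.independent.injective.ne (by decide))
  rw [hsum] at hT hdT
  generalize dist (R.points 0) (R.points 1) = c at *
  generalize ∑ j, r j = s at *
  refine ⟨s, ?_, ?_⟩
  · rintro rfl
    simp at hdT
  · have hsq : (N * twiceArea R) ^ 2 = (s ^ 2 * (2 - (q : ℝ) ^ 2) * twiceArea R) ^ 2 := by
      rw [hT, mul_pow _ (twiceArea R), hR]
      ring
    have h2 : 0 ≤ 2 - (q : ℝ) ^ 2 := by linarith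
    have := (pow_left_inj₀ (by positivity) (by positivity) two_ne_zero).1 hsq
    have := mul_right_cancel₀ hRpos.ne' this
    exact_mod_cast this

theorem isSquare_iff_of_mul_sq_eq {F : Type*} [Field F] {x y a b : F} (ha : a ≠ 0) (hb : b ≠ 0)
    (h : x * a ^ 2 = b ^ 2 * y) : IsSquare x ↔ IsSquare y := by
  constructor
  · rintro ⟨z, rfl⟩
    refine ⟨z * a / b, ?_⟩
    field_simp
    linear_combination -h
  · rintro ⟨z, rfl⟩
    refine ⟨b * z / a, ?_⟩
    field_simp
    linear_combination h

end TriangleTiling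

theorem mainTheorem3 (T : TriangleTiling.Tri) (A B C : ℝ)
    (hA : TriangleTiling.angleAt T 0 = A)
    (hB : TriangleTiling.angleAt T 1 = B)
    (hC : TriangleTiling.angleAt T 2 = C)
    (hT : TriangleTiling.IncommensurableAngles T)
    (hABC : C = A / 2 + B)
    (M K : ℤ) (hK : K ≠ 0)
    (hMK : 2 * Real.sin (A / 4) = (M : ℝ) / (K : ℝ)) :
    (∃ (R : TriangleTiling.Tri) (N : ℕ),
      TriangleTiling.angleAt R 0 = A / 2 ∧ TriangleTiling.angleAt R 1 = B ∧
        TriangleTiling.HasTiling T R N) ∧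
    (∀ (R : TriangleTiling.Tri) (N : ℕ),
      TriangleTiling.angleAt R 0 = A / 2 → TriangleTiling.angleAt R 1 = B →
        TriangleTiling.HasTiling T R N →
          (IsSquare N ↔ IsSquare (2 * K ^ 2 - M ^ 2))) := by
  open TriangleTiling in
  have hsum := angleAt_sum T
  have hA0 := angleAt_pos T 0
  have hB0 := angleAt_pos T 1
  rw [hA] at hA0
  rw [hB] at hB0
  rw [hA, hB, hC] at hsum
  obtain ⟨θ, rfl⟩ : ∃ θ, A = 4 * θ := ⟨A / 4, by ring⟩
  obtain rfl : B = Real.pi / 2 - 3 * θ := by linarith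
  rw [mul_div_cancel_left₀ θ (by norm_num)] at hMK
  rw [show 4 * θ / 2 = 2 * θ by ring]
  have hθ : 0 < θ := by linarith
  have hθ' : 6 * θ < Real.pi := by linarith
  have hs0 : 0 < 2 * Real.sin θ := by
    have := Real.sin_pos_of_pos_of_lt_pi hθ (by linarith)
    positivity
  have hs1 : 2 * Real.sin θ < 1 := by
    have : Real.sin θ < Real.sin (Real.pi / 6) :=
      Real.sin_lt_sin_of_lt_of_le_pi_div_two (by linarith) (by linarith) (by linarith)
    rw [Real.sin_pi_div_six] at this
    linarith
  obtain ⟨hT12, hT02⟩ := tiled_sides hA hB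
  have hL : 0 < dist (T.points 0) (T.points 1) :=
    dist_pos.2 (T.independent.injective.ne (by decide))
  constructor
  · have hKr : (0 : ℝ) < |(K : ℝ)| := by positivity
    have habs : 2 * Real.sin θ = (M.natAbs : ℝ) / K.natAbs := by
      rw [Nat.cast_natAbs, Nat.cast_natAbs, Int.cast_abs, Int.cast_abs, ← abs_div, ← hMK,
        abs_of_pos hs0]
    have hKn : (0 : ℝ) < K.natAbs := by
      rw [Nat.cast_natAbs, Int.cast_abs]
      exact hKr
    have hm : 0 < M.natAbs := by
      rw [habs] at hs0
      exact_mod_cast (div_pos_iff_of_pos_right hKn).1 hs0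
    have hmk : M.natAbs < K.natAbs := by
      rw [habs, div_lt_one hKn] at hs1
      exact_mod_cast hs1
    obtain ⟨R, c, hc, r01, r12, r02, hR⟩ :=
      exists_tiling_of_sides T (t := (2 * Real.sin θ) ^ 2) hm hmk hL (by rw [habs]) rfl
        (by rw [hT12]; ring) (by rw [hT02]; ring)
    obtain ⟨h0, h1⟩ := tile_angles hθ hθ' hc r01 r12 r02
    obtain ⟨N, hN⟩ := hR.exists_hasTiling
    exact ⟨R, N, h0, h1, hN⟩
  · rintro R N hR0 hR1 ⟨t, ht⟩
    obtain ⟨hR12, hR02⟩ := tile_sides hR0 hR1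
    have hq : 2 * Real.sin θ = ((M / K : ℚ) : ℝ) := by
      rw [hMK]
      push_cast
      rfl
    rw [hq] at hT12 hT02 hR12 hR02 hs0 hs1
    obtain ⟨r, hr, hN⟩ := ht.exists_card_eq hR12 hR02 hT12 hT02 (by nlinarith)
    have hK' : (K : ℚ) ≠ 0 := by exact_mod_cast hK
    rw [← Rat.isSquare_natCast_iff, ← Rat.isSquare_intCast_iff]
    refine isSquare_iff_of_mul_sq_eq hK' hr ?_
    rw [hN]
    push_cast
    field_simp
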